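/- Let $\Sigma=\{x,v\}$, let "word" mean a finite (possibly empty) word on $\Sigma$, and let $\mathcal{P}$ be the semigroup presentation with generators $x,v$ and the eight rules $s\to t$ with $s\in\{x,v\}$, $t\in\{xx,xv,vx,vv\}$. For words $w,w'$, a diagram from $w$ to $w'$ is a finite sequence $w=w_1\to w_2\to\cdots\to w_n=w'$ in which each step (a cell) has the form $p(a)q\to p(b)q$, where $a\to b$ or $b\to a$ is a rule; the place and the rule used are part of the data. Two diagrams are equivalent if they are connected by insertions and reductions of dipoles (a step $p(a)q\to p(b)q$ followed at once by its inverse $p(b)q\to p(a)q$) and by exchanges of consecutive cells acting on disjoint subwords. Virtual Thompson's group $VF=\mathcal{D}(\mathcal{P},x)$ is the group of equivalence classes of diagrams from $x$ to $x$, with concatenation as product. Theorem. $VF$ admits the following infinite presentation. Generators: - $X_{v\to vv},\ X_{v\to vx},\ X_{v\to xv}$; - $X_{x,s\to t,u},\ X_{v,s\to t,u}$, where $s\in\{x,v\}$, $t\in\{xx,xv,vx,vv\}$ and $u$ is a word; - $X_{x\to vv,u},\ X_{x\to vx,u},\ X_{v\to xx,u},\ X_{v\to xv,u}$, where $u$ is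 a non-empty word. Relations, for all $s,s_1,s_2\in\{x,v\}$, all $t,t_1,t_2\in\{xx,xv,vx,vv\}$ and all words $p,q$: - $X_{x,s_1\to t_1,ps_2q}\,X_{x,s_2\to t_2,q}=X_{x,s_2\to t_2,q}\,X_{x,s_1\to t_1,pt_2q}$; - $X_{v,s_1\to t_1,ps_2q}\,X_{v,s_2\to t_2,q}=X_{v,s_2\to t_2,q}\,X_{v,s_1\to t_1,pt_2q}$; - $X_{x,s\to t,q}\,X_{x\to vv,ptq}=X_{x\to vv,psq}\,X_{v,s\to t,q}$; - $X_{x,s\to t,q}\,X_{x\to vx,ptq}=X_{x\to vx,psq}\,X_{v,s\to t,q}$; - $X_{v,s\to t,q}\,X_{v\to xx,ptq}=X_{v\to xx,psq}\,X_{x,s\to t,q}$; - $X_{v,s\to t,q}\,X_{v\to xv,ptq}=X_{v\to xv,psq}\,X_{x,s\to t,q}$. More precisely, there are diagrams $T_w$ from $x$ to $w$, one for each non-empty word $w$, such that an isomorphism from the presented group to $VF$ is given by sending each generator to the class of the diagram $T_{w}\cdot(w\to w')\cdot T_{w'}^{-1}$, where $w\to w'$ is the cell in the index of the generator: $(s)\to(t)$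 for $X_{s\to t}$, $a(s)u\to a(t)u$ for $X_{a,s\to t,u}$, and $(s)u\to(t)u$ for $X_{s\to t,u}$. Consequently, $VF$ is the internal free product of the free group of rank $3$ freely generated by $X_{v\to vv}, X_{v\to vx}, X_{v\to xv}$ and the subgroup generated by all the other generators. -/

import Mathlib

/-- A finite semigroup presentation on the alphabet `α`: a finite set of rewriting rules `u → v`
between nonempty words, none of them of the form `u → u`. Words are lists of letters. -/
structure SemigroupPresentation (α : Type*) where
  rules : Finset (List α × List α)
  left_ne_nil : ∀ r ∈ rules, r.1 ≠ []
  right_ne_nil : ∀ r ∈ rules, r.2 ≠ []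
  left_ne_right : ∀ r ∈ rules, r.1 ≠ r.2

namespace SemigroupPresentation

variable {α : Type*}

/-- A cell `pre (src) suf → pre (tgt) suf`. A rule may be applied in both directions. -/
@[ext]
structure Cell (P : SemigroupPresentation α) where
  pre : List α
  src : List α
  tgt : List α
  suf : List α
  rule : (src, tgt) ∈ P.rules ∨ (tgt, src) ∈ P.rules

namespace Cell

variable {P : SemigroupPresentation α}

/-- The word that the cell is applied to. -/
def top (c : P.Cell) : List α := c.pre ++ c.src ++ c.suf

/-- The word that the cell produces. -/
def bot (c : P.Cell) : List α := c.pre ++ c.tgt ++ c.suf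

/-- The cell read backwards. -/
def inv (c : P.Cell) : P.Cell := ⟨c.pre, c.tgt, c.src, c.suf, c.rule.symm⟩

@[simp] theorem inv_inv (c : P.Cell) : c.inv.inv = c := rfl
@[simp] theorem top_inv (c : P.Cell) : c.inv.top = c.bot := rfl
@[simp] theorem bot_inv (c : P.Cell) : c.inv.bot = c.top := rfl

theorem top_ne_nil (c : P.Cell) : c.top ≠ [] := by
  have h : c.src ≠ [] := c.rule.elim (P.left_ne_nil _) (P.right_ne_nil _)
  simp [top, h]

theorem bot_ne_nil (c : P.Cell) : c.bot ≠ [] := c.inv.top_ne_nil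

end Cell

variable (P : SemigroupPresentation α)

/-- The cells of `l` can be applied successively, starting from `w` and ending at `w'`. -/
def IsDiagram : List α → List P.Cell → List α → Prop
  | w, [], w' => w = w'
  | w, c :: l, w' => w = c.top ∧ IsDiagram c.bot l w'

variable {P}

theorem isDiagram_append {l₁ l₂ : List P.Cell} {a b : List α} :
    P.IsDiagram a (l₁ ++ l₂) b ↔ ∃ w, P.IsDiagram a l₁ w ∧ P.IsDiagram w l₂ b := by
  induction l₁ generalizing a with
  | nil => simp [IsDiagram]
  | cons c l ih => simp [IsDiagram, ih, and_assoc]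

theorem IsDiagram.append {l₁ l₂ : List P.Cell} {a b c : List α}
    (h₁ : P.IsDiagram a l₁ b) (h₂ : P.IsDiagram b l₂ c) : P.IsDiagram a (l₁ ++ l₂) c :=
  isDiagram_append.2 ⟨b, h₁, h₂⟩

theorem IsDiagram.inv {l : List P.Cell} {a b : List α} (h : P.IsDiagram a l b) :
    P.IsDiagram b (l.reverse.map Cell.inv) a := by
  induction l generalizing a with
  | nil => exact Eq.symm h
  | cons c l ih =>
    obtain ⟨rfl, h⟩ := h
    simp only [List.reverse_cons, List.map_append]
    exact (ih h).append ⟨rfl, rfl⟩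

variable (P) in
/-- A diagram from `w` to `w'`: a finite sequence of rewritings `w = w₁ → w₂ → ⋯ → wₙ = w'`,
each of them with the place and the rule that it uses. -/
structure Diagram (w w' : List α) where
  cells : List P.Cell
  isDiagram : P.IsDiagram w cells w'

namespace Diagram

/-- The elementary moves on diagrams: the reduction of a dipole, and the exchange of two
consecutive separated cells. -/
inductive Move {w w' : List α} : P.Diagram w w' → P.Diagram w w' → Prop
  | dipole (l₁ l₂ : List P.Cell) (c : P.Cell)
      (h : P.IsDiagram w (l₁ ++ [c, c.inv] ++ l₂) w') (h' : P.IsDiagram w (l₁ ++ l₂) w') :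
      Move ⟨l₁ ++ [c, c.inv] ++ l₂, h⟩ ⟨l₁ ++ l₂, h'⟩
  | commute (l₁ l₂ : List P.Cell) (p q r u₁ v₁ u₂ v₂ : List α)
      (h₁ : (u₁, v₁) ∈ P.rules ∨ (v₁, u₁) ∈ P.rules)
      (h₂ : (u₂, v₂) ∈ P.rules ∨ (v₂, u₂) ∈ P.rules)
      (h : P.IsDiagram w (l₁ ++ [⟨p, u₁, v₁, q ++ u₂ ++ r, h₁⟩,
        ⟨p ++ v₁ ++ q, u₂, v₂, r, h₂⟩] ++ l₂) w')
      (h' : P.IsDiagram w (l₁ ++ [⟨p ++ u₁ ++ q, u₂, v₂, r, h₂⟩,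
        ⟨p, u₁, v₁, q ++ v₂ ++ r, h₁⟩] ++ l₂) w') :
      Move ⟨l₁ ++ [⟨p, u₁, v₁, q ++ u₂ ++ r, h₁⟩, ⟨p ++ v₁ ++ q, u₂, v₂, r, h₂⟩] ++ l₂, h⟩
        ⟨l₁ ++ [⟨p ++ u₁ ++ q, u₂, v₂, r, h₂⟩, ⟨p, u₁, v₁, q ++ v₂ ++ r, h₁⟩] ++ l₂, h'⟩

/-- Concatenation of diagrams. -/
def comp {a b c : List α} (d : P.Diagram a b) (e : P.Diagram b c) : P.Diagram a c :=
  ⟨d.cells ++ e.cells, d.isDiagram.append e.isDiagram⟩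

/-- The diagram read backwards. -/
def inv {a b : List α} (d : P.Diagram a b) : P.Diagram b a :=
  ⟨d.cells.reverse.map Cell.inv, d.isDiagram.inv⟩

/-- The diagram without cells. -/
def trivial (w : List α) : P.Diagram w w := ⟨[], rfl⟩

/-- The diagram that consists of a single cell. -/
def single (c : P.Cell) : P.Diagram c.top c.bot := ⟨[c], rfl, rfl⟩

theorem Move.comp_left {a b c : List α} (d : P.Diagram a b) {e e' : P.Diagram b c}
    (h : Move e e') : Move (d.comp e) (d.comp e') := by
  obtain ⟨l, hl⟩ := d
  cases h with
  | dipole l₁ l₂ x h h' =>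
    have key := Move.dipole (w := a) (w' := c) (l ++ l₁) l₂ x
      (by simpa [List.append_assoc] using hl.append h)
      (by simpa [List.append_assoc] using hl.append h')
    simpa [Diagram.comp, List.append_assoc] using key
  | commute l₁ l₂ p q r u₁ v₁ u₂ v₂ h₁ h₂ h h' =>
    have key := Move.commute (w := a) (w' := c) (l ++ l₁) l₂ p q r u₁ v₁ u₂ v₂ h₁ h₂
      (by simpa [List.append_assoc] using hl.append h)
      (by simpa [List.append_assoc] using hl.append h')
    simpa [Diagram.comp, List.append_assoc] using key

theorem Move.comp_right {a b c : List α} {d d' : P.Diagram a b} (e : P.Diagram b c)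
    (h : Move d d') : Move (d.comp e) (d'.comp e) := by
  obtain ⟨l, hl⟩ := e
  cases h with
  | dipole l₁ l₂ x h h' =>
    have key := Move.dipole (w := a) (w' := c) l₁ (l₂ ++ l) x
      (by simpa [List.append_assoc] using h.append hl)
      (by simpa [List.append_assoc] using h'.append hl)
    simpa [Diagram.comp, List.append_assoc] using key
  | commute l₁ l₂ p q r u₁ v₁ u₂ v₂ h₁ h₂ h h' =>
    have key := Move.commute (w := a) (w' := c) l₁ (l₂ ++ l) p q r u₁ v₁ u₂ v₂ h₁ h₂
      (by simpa [List.append_assoc] using h.append hl)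
      (by simpa [List.append_assoc] using h'.append hl)
    simpa [Diagram.comp, List.append_assoc] using key

theorem Move.inv {a b : List α} {d d' : P.Diagram a b} (h : Move d d') :
    Move d.inv d'.inv ∨ Move d'.inv d.inv := by
  cases h with
  | dipole l₁ l₂ x h h' =>
    left
    have key := Move.dipole (w := b) (w' := a) (l₂.reverse.map Cell.inv)
      (l₁.reverse.map Cell.inv) x
      (by simpa [List.append_assoc] using h.inv) (by simpa [List.append_assoc] using h'.inv)
    simpa [Diagram.inv, List.append_assoc] using key
  | commute l₁ l₂ p q r u₁ v₁ u₂ v₂ h₁ h₂ h h' =>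
    right
    have key := Move.commute (w := b) (w' := a) (l₂.reverse.map Cell.inv)
      (l₁.reverse.map Cell.inv) p q r v₁ u₁ v₂ u₂ h₁.symm h₂.symm
      (by simpa [List.append_assoc, Cell.inv] using h'.inv)
      (by simpa [List.append_assoc, Cell.inv] using h.inv)
    simpa [Diagram.inv, List.append_assoc, Cell.inv] using key

end Diagram

variable (P) in
/-- Diagrams from `w` to `w'` up to the equivalence relation generated by the elementary moves. -/
def DiagramClass (w w' : List α) : Type _ := Quot (Diagram.Move (P := P) (w := w) (w' := w'))

/-- The equivalence class of a diagram. -/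
def Diagram.toClass {w w' : List α} (d : P.Diagram w w') : P.DiagramClass w w' := Quot.mk _ d

variable (P) in
/-- The diagram group with base word `w`. -/
abbrev DiagramGroup (w : List α) : Type _ := P.DiagramClass w w

theorem Diagram.comp_inv_toClass {a b : List α} (d : P.Diagram a b) :
    (d.comp d.inv).toClass = (Diagram.trivial a).toClass := by
  obtain ⟨l, hl⟩ := d
  induction l generalizing a with
  | nil => rfl
  | cons c l ih =>
    obtain ⟨rfl, hl⟩ := hl
    have h1 := ih hl
    have h2 : ∀ e e' : P.Diagram c.bot c.bot, e.toClass = e'.toClass →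
        (((single c).comp e).comp (single c).inv).toClass =
          (((single c).comp e').comp (single c).inv).toClass := by
      intro e e' he
      have := congrArg (Quot.map (fun e : P.Diagram c.bot c.bot =>
        ((single c).comp e).comp (single c).inv)
        (fun e e' h => (h.comp_left _).comp_right _)) he
      exact this
    have h3 := h2 _ _ h1
    have h4 : (((single c).comp (trivial c.bot)).comp (single c).inv).toClass =
        (trivial (P := P) c.top).toClass :=
      Quot.sound (Move.dipole [] [] c ⟨rfl, rfl, rfl⟩ rfl)
    rw [h4] at h3
    rw [← h3]
    simp [comp, inv, single, List.append_assoc]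

theorem Diagram.inv_inv {a b : List α} (d : P.Diagram a b) : d.inv.inv = d := by
  obtain ⟨l, hl⟩ := d
  simp [Diagram.inv, List.map_reverse, Function.comp_def]

/-- The multiplication of the diagram group is the concatenation of diagrams. -/
instance (w : List α) : Group (P.DiagramGroup w) where
  mul := Quot.map₂ Diagram.comp (fun d _ _ h => h.comp_left d) (fun _ _ e h => h.comp_right e)
  one := (Diagram.trivial w).toClass
  inv := Quot.lift (fun d => d.inv.toClass)
    (fun _ _ h => h.inv.elim (fun h => Quot.sound h) (fun h => (Quot.sound h).symm))
  mul_assoc := by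
    rintro ⟨a⟩ ⟨b⟩ ⟨c⟩
    exact congrArg Diagram.toClass (by simp [Diagram.comp])
  one_mul := by
    rintro ⟨a⟩
    rfl
  mul_one := by
    rintro ⟨a⟩
    exact congrArg Diagram.toClass (by simp [Diagram.comp, Diagram.trivial])
  inv_mul_cancel := by
    rintro ⟨a⟩
    have h := Diagram.comp_inv_toClass a.inv
    rw [Diagram.inv_inv] at h
    exact h

end SemigroupPresentation

namespace VirtualThompson

/-- The alphabet `{x, v}`. -/
inductive Letter
  | x
  | v
  deriving DecidableEq

open Letter

/-- The semigroup presentation with generators `x, v` and the eight rules `s → t`, where `s` is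
`x` or `v` and `t` is one of `xx, vv, vx, xv`. -/
def presentation : SemigroupPresentation Letter where
  rules := {([x], [x, x]), ([x], [v, v]), ([x], [v, x]), ([x], [x, v]),
    ([v], [v, v]), ([v], [x, x]), ([v], [v, x]), ([v], [x, v])}
  left_ne_nil := by decide
  right_ne_nil := by decide
  left_ne_right := by decide

theorem rule_mem (s t₁ t₂ : Letter) : ([s], [t₁, t₂]) ∈ presentation.rules := by
  cases s <;> cases t₁ <;> cases t₂ <;> decide

/-- Virtual Thompson's group. -/
abbrev VF : Type := presentation.DiagramGroup [x]

/-- The generators of the presentation of `VF`. The two-letter word `t` is written `t₁ t₂`. -/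
inductive Gen
  /-- `X_{v → vv}` -/
  | v_vv
  /-- `X_{v → vx}` -/
  | v_vx
  /-- `X_{v → xv}` -/
  | v_xv
  /-- `X_{a, s → t, u}` with `a, s ∈ {x, v}`, `t ∈ {xx, xv, vx, vv}` and `u` any word -/
  | X (a s t₁ t₂ : Letter) (u : List Letter)
  /-- `X_{x → vv, u}` with `u` nonempty -/
  | x_vv (u : List Letter) (hu : u ≠ [])
  /-- `X_{x → vx, u}` with `u` nonempty -/
  | x_vx (u : List Letter) (hu : u ≠ [])
  /-- `X_{v → xx, u}` with `u` nonempty -/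
  | v_xx (u : List Letter) (hu : u ≠ [])
  /-- `X_{v → xv, u}` with `u` nonempty -/
  | v_xv' (u : List Letter) (hu : u ≠ [])

namespace Gen

/-- The cell (1-cell of the Squier complex) that a generator is named after. -/
def cell : Gen → presentation.Cell
  | v_vv => ⟨[], [v], [v, v], [], Or.inl (rule_mem _ _ _)⟩
  | v_vx => ⟨[], [v], [v, x], [], Or.inl (rule_mem _ _ _)⟩
  | v_xv => ⟨[], [v], [x, v], [], Or.inl (rule_mem _ _ _)⟩
  | X a s t₁ t₂ u => ⟨[a], [s], [t₁, t₂], u, Or.inl (rule_mem _ _ _)⟩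
  | x_vv u _ => ⟨[], [x], [v, v], u, Or.inl (rule_mem _ _ _)⟩
  | x_vx u _ => ⟨[], [x], [v, x], u, Or.inl (rule_mem _ _ _)⟩
  | v_xx u _ => ⟨[], [v], [x, x], u, Or.inl (rule_mem _ _ _)⟩
  | v_xv' u _ => ⟨[], [v], [x, v], u, Or.inl (rule_mem _ _ _)⟩

end Gen

theorem mid_ne_nil (p m q : List Letter) (hm : m ≠ []) : p ++ m ++ q ≠ [] := by
  simp [hm]

open FreeGroup in
/-- The relations of the presentation of `VF`: `IsRelation l r` means that `l = r` is one of
them. -/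
inductive IsRelation : FreeGroup Gen → FreeGroup Gen → Prop
  | xx (s₁ a₁ b₁ s₂ a₂ b₂ : Letter) (p q : List Letter) : IsRelation
      (of (.X x s₁ a₁ b₁ (p ++ [s₂] ++ q)) * of (.X x s₂ a₂ b₂ q))
      (of (.X x s₂ a₂ b₂ q) * of (.X x s₁ a₁ b₁ (p ++ [a₂, b₂] ++ q)))
  | vv (s₁ a₁ b₁ s₂ a₂ b₂ : Letter) (p q : List Letter) : IsRelation
      (of (.X v s₁ a₁ b₁ (p ++ [s₂] ++ q)) * of (.X v s₂ a₂ b₂ q))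
      (of (.X v s₂ a₂ b₂ q) * of (.X v s₁ a₁ b₁ (p ++ [a₂, b₂] ++ q)))
  | x_vv (s a b : Letter) (p q : List Letter) : IsRelation
      (of (.X x s a b q) * of (.x_vv (p ++ [a, b] ++ q) (mid_ne_nil _ _ _ (by simp))))
      (of (.x_vv (p ++ [s] ++ q) (mid_ne_nil _ _ _ (by simp))) * of (.X v s a b q))
  | x_vx (s a b : Letter) (p q : List Letter) : IsRelation
      (of (.X x s a b q) * of (.x_vx (p ++ [a, b] ++ q) (mid_ne_nil _ _ _ (by simp))))
      (of (.x_vx (p ++ [s] ++ q) (mid_ne_nil _ _ _ (by simp))) * of (.X v s a b q))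
  | v_xx (s a b : Letter) (p q : List Letter) : IsRelation
      (of (.X v s a b q) * of (.v_xx (p ++ [a, b] ++ q) (mid_ne_nil _ _ _ (by simp))))
      (of (.v_xx (p ++ [s] ++ q) (mid_ne_nil _ _ _ (by simp))) * of (.X x s a b q))
  | v_xv (s a b : Letter) (p q : List Letter) : IsRelation
      (of (.X v s a b q) * of (.v_xv' (p ++ [a, b] ++ q) (mid_ne_nil _ _ _ (by simp))))
      (of (.v_xv' (p ++ [s] ++ q) (mid_ne_nil _ _ _ (by simp))) * of (.X x s a b q))

/-- The relators `l r⁻¹`, where `l = r` is a relation. -/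
def relators : Set (FreeGroup Gen) := {g | ∃ l r, IsRelation l r ∧ g = l * r⁻¹}

/-- The generators other than `X_{v → vv}`, `X_{v → vx}` and `X_{v → xv}`. -/
def otherGens : Set Gen := {g | g ≠ .v_vv ∧ g ≠ .v_vx ∧ g ≠ .v_xv}

end VirtualThompson

namespace SemigroupPresentation

/-! ### Concatenation of diagrams up to equivalence. -/

variable {α : Type*} {P : SemigroupPresentation α}

/-! `VF` is the fundamental group at `x` of the Squier complex: vertices are nonempty words, edges
are cells, and each pair of cells on disjoint subwords bounds a square. Collapsing a spanning tree
leaves one generator per cell, trivial on tree cells, and one relation per square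
(`loop_edge_mul_loop_edge`).

The tree contains every cell `(a) → (ab)` followed by a nonempty word. A square with two such
opposite sides identifies its other two sides, so a cell with nonempty prefix depends only on the
first letter of that prefix (`loop_edge_cons`). The surviving generators are those of `Gen` and the
surviving squares are the relations.

The isomorphism comes from two inverse homomorphisms: `ofPresented` sends generators to loops, and
`toPresented` multiplies cell values along a diagram, which is legitimate by `cellValue_commute`.
The cells `v → vv`, `v → vx`, `v → xv` with empty context leave no room for a disjoint cell, so no
relation involves them and they split off as a free factor. -/

theorem Diagram.comp_toClass_congr {a b c : List α} {d d' : P.Diagram a b} {e e' : P.Diagram b c}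
    (hd : d.toClass = d'.toClass) (he : e.toClass = e'.toClass) :
    (d.comp e).toClass = (d'.comp e').toClass :=
  congrArg₂ (Quot.map₂ Diagram.comp (fun d _ _ h => h.comp_left d)
    (fun _ _ e h => h.comp_right e) :
      P.DiagramClass a b → P.DiagramClass b c → P.DiagramClass a c) hd he

theorem Diagram.comp_assoc {a b c d : List α} (f : P.Diagram a b) (g : P.Diagram b c)
    (h : P.Diagram c d) : (f.comp g).comp h = f.comp (g.comp h) := by
  simp [Diagram.comp]

theorem Diagram.comp_inv_comp_toClass {a b c : List α} (d : P.Diagram b a) (e : P.Diagram a c) :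
    (d.inv.comp (d.comp e)).toClass = e.toClass := by
  rw [← Diagram.comp_assoc]
  have h := Diagram.comp_inv_toClass d.inv
  rw [Diagram.inv_inv] at h
  exact (Diagram.comp_toClass_congr h rfl).trans rfl

theorem Diagram.toClass_mul {a : List α} (d e : P.Diagram a a) :
    (d.toClass * e.toClass : P.DiagramGroup a) = (d.comp e).toClass := rfl

end SemigroupPresentation

namespace VirtualThompson

open Letter SemigroupPresentation

/-- The cell that applies the rule `s → ab` between the words `p` and `q`. -/
def edge (p : List Letter) (s a b : Letter) (q : List Letter) : presentation.Cell :=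
  ⟨p, [s], [a, b], q, Or.inl (rule_mem s a b)⟩

theorem eq_of_rule_mem {u v : List Letter} (h : (u, v) ∈ presentation.rules) :
    ∃ s a b, u = [s] ∧ v = [a, b] := by
  simp only [presentation, Finset.mem_insert, Finset.mem_singleton, Prod.mk.injEq] at h
  rcases h with ⟨rfl, rfl⟩ | ⟨rfl, rfl⟩ | ⟨rfl, rfl⟩ | ⟨rfl, rfl⟩ | ⟨rfl, rfl⟩ | ⟨rfl, rfl⟩ |
    ⟨rfl, rfl⟩ | ⟨rfl, rfl⟩ <;> exact ⟨_, _, _, rfl, rfl⟩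

theorem exists_eq_edge (c : presentation.Cell) :
    ∃ p s a b q, c = edge p s a b q ∨ c = (edge p s a b q).inv := by
  obtain ⟨p, u, v, q, h⟩ := c
  rcases h with h | h
  · obtain ⟨s, a, b, rfl, rfl⟩ := eq_of_rule_mem h
    exact ⟨p, s, a, b, q, Or.inl rfl⟩
  · obtain ⟨s, a, b, rfl, rfl⟩ := eq_of_rule_mem h
    exact ⟨p, s, a, b, q, Or.inr rfl⟩

/-! ### The spanning tree -/

/-- The path from `x` to a nonempty word in the spanning tree of the Squier complex: words of
length two are reached from `x` directly, `v` is reached through `xx`, and a longer word `abcu`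
is reached from `acu`. -/
def treeCells : List Letter → List presentation.Cell
  | [] => []
  | [x] => []
  | [v] => [edge [] x x x [], (edge [] v x x []).inv]
  | [a, b] => [edge [] x a b []]
  | a :: b :: c :: u => treeCells (a :: c :: u) ++ [edge [] a a b (c :: u)]
termination_by w => w.length

theorem isDiagram_treeCells : (w : List Letter) → w ≠ [] →
    presentation.IsDiagram [x] (treeCells w) w
  | [], h => absurd rfl h
  | [x], _ => by rw [treeCells]; rfl
  | [v], _ => by rw [treeCells]; exact ⟨rfl, rfl, rfl⟩
  | [a, b], _ => by rw [treeCells]; exact ⟨rfl, rfl⟩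
  | a :: b :: c :: u, _ => by
    rw [treeCells]
    exact (isDiagram_treeCells (a :: c :: u) (by simp)).append ⟨rfl, rfl⟩
termination_by w => w.length

/-- The path from `x` to a nonempty word in the spanning tree, as a diagram. -/
def tree (w : List Letter) (hw : w ≠ []) : presentation.Diagram [x] w :=
  ⟨treeCells w, isDiagram_treeCells w hw⟩

/-! ### Diagrams closed up along the tree -/

/-- The element of `VF` obtained by closing up a diagram along the spanning tree. -/
def closeUp {a b : List Letter} (ha : a ≠ []) (hb : b ≠ []) (d : presentation.Diagram a b) : VF :=
  (((tree a ha).comp d).comp (tree b hb).inv).toClass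

/-- The return along the tree from `b` cancels against the following departure to `b`. -/
theorem closeUp_comp {a b c : List Letter} (ha : a ≠ []) (hb : b ≠ []) (hc : c ≠ [])
    (d : presentation.Diagram a b) (e : presentation.Diagram b c) :
    closeUp ha hc (d.comp e) = closeUp ha hb d * closeUp hb hc e := by
  simp only [closeUp, Diagram.toClass_mul, Diagram.comp_assoc]
  refine Diagram.comp_toClass_congr rfl (Diagram.comp_toClass_congr rfl ?_)
  exact (Diagram.comp_inv_comp_toClass _ _).symm

theorem closeUp_eq_of_toClass_eq {a b : List Letter} (ha : a ≠ []) (hb : b ≠ [])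
    {d e : presentation.Diagram a b} (h : d.toClass = e.toClass) :
    closeUp ha hb d = closeUp ha hb e :=
  Diagram.comp_toClass_congr (Diagram.comp_toClass_congr rfl h) rfl

theorem closeUp_trivial {a : List Letter} (ha : a ≠ []) : closeUp ha ha (.trivial a) = 1 := by
  have h : (tree a ha).comp (.trivial a) = tree a ha := by simp [Diagram.comp, Diagram.trivial]
  rw [closeUp, h]
  exact Diagram.comp_inv_toClass _

theorem closeUp_self (d : presentation.Diagram [x] [x]) :
    closeUp (by simp) (by simp) d = d.toClass := by
  have h : tree [x] (by simp) = .trivial [x] := by simp [tree, treeCells, Diagram.trivial]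
  rw [closeUp, h]
  exact congrArg Diagram.toClass (by simp [Diagram.comp, Diagram.trivial, Diagram.inv])

/-- The element of `VF` represented by a cell, closed up along the spanning tree. -/
def loop (c : presentation.Cell) : VF := closeUp c.top_ne_nil c.bot_ne_nil (.single c)

/-- Cutting a diagram at each intermediate word shows that the loops of single cells generate `VF`.
-/
theorem closeUp_mk {a b : List Letter} (ha : a ≠ []) (hb : b ≠ []) (l : List presentation.Cell)
    (h : presentation.IsDiagram a l b) : closeUp ha hb ⟨l, h⟩ = (l.map loop).prod := by
  induction l generalizing a with
  | nil =>
    obtain rfl : a = b := h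
    exact closeUp_trivial ha
  | cons c l ih =>
    obtain ⟨rfl, h⟩ := h
    rw [List.map_cons, List.prod_cons, ← ih c.bot_ne_nil h]
    exact closeUp_comp _ _ _ (.single c) ⟨l, h⟩

theorem loop_inv (c : presentation.Cell) : loop c.inv = (loop c)⁻¹ := by
  rw [eq_inv_iff_mul_eq_one, ← closeUp_trivial c.bot_ne_nil]
  refine (closeUp_comp _ _ _ (.single c.inv) (.single c)).symm.trans
    (closeUp_eq_of_toClass_eq _ _ ?_)
  exact Diagram.comp_inv_toClass (.single c.inv)

theorem loop_edge_mul_loop_edge (p q r : List Letter) (s₁ a₁ b₁ s₂ a₂ b₂ : Letter) :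
    loop (edge p s₁ a₁ b₁ (q ++ [s₂] ++ r)) * loop (edge (p ++ [a₁, b₁] ++ q) s₂ a₂ b₂ r) =
      loop (edge (p ++ [s₁] ++ q) s₂ a₂ b₂ r) * loop (edge p s₁ a₁ b₁ (q ++ [a₂, b₂] ++ r)) := by
  have ha : p ++ [s₁] ++ (q ++ [s₂] ++ r) ≠ [] := by simp
  have hb : p ++ [a₁, b₁] ++ (q ++ [a₂, b₂] ++ r) ≠ [] := by simp
  have h := Diagram.Move.commute (P := presentation) (w := p ++ [s₁] ++ (q ++ [s₂] ++ r))
    (w' := p ++ [a₁, b₁] ++ (q ++ [a₂, b₂] ++ r)) [] [] p q r _ _ _ _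
    (Or.inl (rule_mem s₁ a₁ b₁)) (Or.inl (rule_mem s₂ a₂ b₂))
    (by simp [IsDiagram, Cell.top, Cell.bot]) (by simp [IsDiagram, Cell.top, Cell.bot])
  have := closeUp_eq_of_toClass_eq ha hb (Quot.sound h)
  simpa [closeUp_mk, edge] using this

/-- If the tree path to the bottom word ends with this cell, the loop runs along that path and
straight back. -/
theorem loop_edge_of_treeCells {s a b : Letter} {q : List Letter}
    (h : treeCells (a :: b :: q) = treeCells (s :: q) ++ [edge [] s a b q]) :
    loop (edge [] s a b q) = 1 := by
  have key : tree (a :: b :: q) (by simp) =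
      (tree (s :: q) (by simp)).comp (.single (edge [] s a b q)) := by
    simp only [tree, h]
    rfl
  show ((Diagram.comp (tree (s :: q) (by simp)) (.single (edge [] s a b q))).comp
    (tree (a :: b :: q) (by simp)).inv).toClass = _
  rw [← key]
  exact Diagram.comp_inv_toClass _

theorem loop_edge_nil_self_cons (a b c : Letter) (u : List Letter) :
    loop (edge [] a a b (c :: u)) = 1 :=
  loop_edge_of_treeCells (by rw [treeCells])

theorem loop_edge_x (a b : Letter) : loop (edge [] x a b []) = 1 :=
  loop_edge_of_treeCells (by simp [treeCells])

/-- This tree cell is traversed backwards, on the path `x → xx → v`, so `loop_edge_of_treeCells`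
does not apply. Closing up that path gives 1, and its first cell is already trivial. -/
theorem loop_edge_v_xx : loop (edge [] v x x []) = 1 := by
  have h := closeUp_mk (by simp) (by simp) _ (isDiagram_treeCells [v] (by simp))
  have h' : closeUp (by simp) (by simp) (tree [v] (by simp)) = 1 := by
    have hx : tree [x] (by simp) = .trivial [x] := by simp [tree, treeCells, Diagram.trivial]
    rw [closeUp, hx]
    exact Diagram.comp_inv_toClass (tree [v] (by simp))
  rw [tree, h] at h'
  simpa [treeCells, loop_edge_x, loop_inv] using h'

theorem loop_edge_cons (h : Letter) (p : List Letter) (s a b : Letter) (q : List Letter) :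
    loop (edge (h :: p) s a b q) = loop (edge [h] s a b q) := by
  induction p with
  | nil => rfl
  | cons k p ih =>
    -- In this square the cells `(h) → (hk)` are tree cells: the word to their right contains the
    -- other cell, so it is nonempty.
    have H := loop_edge_mul_loop_edge [] p q h h k s a b
    have h1 (w : List Letter) (hw : w ≠ []) : loop (edge [] h h k w) = 1 := by
      obtain ⟨c, u, rfl⟩ := List.exists_cons_of_ne_nil hw
      exact loop_edge_nil_self_cons h k c u
    rw [h1 _ (by simp), h1 _ (by simp), one_mul, mul_one] at H
    exact H.trans ih

/-! ### The homomorphism from the presented group -/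

theorem loop_lift_relators : ∀ r ∈ relators,
    FreeGroup.lift (fun g : Gen => loop g.cell) r = 1 := by
  rintro _ ⟨l, r, h, rfl⟩
  rw [map_mul, map_inv, mul_inv_eq_one]
  cases h <;> simp only [map_mul, FreeGroup.lift_apply_of]
  case xx s₁ a₁ b₁ s₂ a₂ b₂ p q =>
    have H := loop_edge_mul_loop_edge [x] p q s₁ a₁ b₁ s₂ a₂ b₂
    simp only [List.nil_append, List.cons_append, loop_edge_cons] at H
    exact H
  case vv s₁ a₁ b₁ s₂ a₂ b₂ p q =>
    have H := loop_edge_mul_loop_edge [v] p q s₁ a₁ b₁ s₂ a₂ b₂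
    simp only [List.nil_append, List.cons_append, loop_edge_cons] at H
    exact H
  case x_vv s a b p q =>
    have H := loop_edge_mul_loop_edge [] p q x v v s a b
    simp only [List.nil_append, List.cons_append, loop_edge_cons] at H
    exact H.symm
  case x_vx s a b p q =>
    have H := loop_edge_mul_loop_edge [] p q x v x s a b
    simp only [List.nil_append, List.cons_append, loop_edge_cons] at H
    exact H.symm
  case v_xx s a b p q =>
    have H := loop_edge_mul_loop_edge [] p q v x x s a b
    simp only [List.nil_append, List.cons_append, loop_edge_cons] at H
    exact H.symm
  case v_xv s a b p q =>
    have H := loop_edge_mul_loop_edge [] p q v x v s a b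
    simp only [List.nil_append, List.cons_append, loop_edge_cons] at H
    exact H.symm

/-- The homomorphism that sends a generator to the loop through the cell it is named after. -/
def ofPresented : PresentedGroup relators →* VF := PresentedGroup.toGroup loop_lift_relators

theorem ofPresented_of (g : Gen) : ofPresented (.of g) = loop g.cell :=
  PresentedGroup.toGroup.of loop_lift_relators

/-! ### The homomorphism to the presented group -/

/-- The element of the presented group that corresponds to the cell `edge p s a b q`. -/
def edgeValue : List Letter → Letter → Letter → Letter → List Letter → PresentedGroup relators
  | h :: _, s, a, b, q => .of (.X h s a b q)
  | [], x, _, _, [] => 1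
  | [], v, x, x, [] => 1
  | [], v, v, v, [] => .of .v_vv
  | [], v, v, x, [] => .of .v_vx
  | [], v, x, v, [] => .of .v_xv
  | [], x, x, _, _ :: _ => 1
  | [], v, v, _, _ :: _ => 1
  | [], x, v, v, c :: u => .of (.x_vv (c :: u) (by simp))
  | [], x, v, x, c :: u => .of (.x_vx (c :: u) (by simp))
  | [], v, x, x, c :: u => .of (.v_xx (c :: u) (by simp))
  | [], v, x, v, c :: u => .of (.v_xv' (c :: u) (by simp))

theorem of_mul_of_eq {g₁ g₂ g₃ g₄ : Gen}
    (h : IsRelation (.of g₁ * .of g₂) (.of g₃ * .of g₄)) :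
    (.of g₁ * .of g₂ : PresentedGroup relators) = .of g₃ * .of g₄ := by
  have := PresentedGroup.one_of_mem (rels := relators) ⟨_, _, h, rfl⟩
  rw [map_mul, map_inv, mul_inv_eq_one, map_mul, map_mul] at this
  exact this

/-- With a nonempty prefix, this is a defining relation for its first letter. With an empty prefix,
it is trivial if `a₁ = s₁`; otherwise it is one of the four mixed relations, read from right to
left. -/
theorem edgeValue_mul_edgeValue (p q r : List Letter) (s₁ a₁ b₁ s₂ a₂ b₂ : Letter) :
    edgeValue p s₁ a₁ b₁ (q ++ [s₂] ++ r) * edgeValue (p ++ [a₁, b₁] ++ q) s₂ a₂ b₂ r =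
      edgeValue (p ++ [s₁] ++ q) s₂ a₂ b₂ r * edgeValue p s₁ a₁ b₁ (q ++ [a₂, b₂] ++ r) := by
  cases p with
  | cons h p =>
    cases h with
    | x => exact of_mul_of_eq (.xx s₁ a₁ b₁ s₂ a₂ b₂ q r)
    | v => exact of_mul_of_eq (.vv s₁ a₁ b₁ s₂ a₂ b₂ q r)
  | nil =>
    have hvv := of_mul_of_eq (.x_vv s₂ a₂ b₂ q r)
    have hvx := of_mul_of_eq (.x_vx s₂ a₂ b₂ q r)
    have hxx := of_mul_of_eq (.v_xx s₂ a₂ b₂ q r)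
    have hxv := of_mul_of_eq (.v_xv s₂ a₂ b₂ q r)
    -- Splitting `q` exposes the head of `q ++ [s₂] ++ r`, which selects the nonempty-context
    -- clauses of `edgeValue`.
    cases s₁ <;> cases a₁ <;> cases b₁ <;> cases q <;> simp_all [edgeValue]

/-- The element of the presented group that corresponds to a cell. -/
def cellValue (c : presentation.Cell) : PresentedGroup relators :=
  match c.src, c.tgt with
  | [s], [a, b] => edgeValue c.pre s a b c.suf
  | [a, b], [s] => (edgeValue c.pre s a b c.suf)⁻¹
  | _, _ => 1

theorem cellValue_edge (p : List Letter) (s a b : Letter) (q : List Letter) :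
    cellValue (edge p s a b q) = edgeValue p s a b q := rfl

theorem cellValue_inv (c : presentation.Cell) : cellValue c.inv = (cellValue c)⁻¹ := by
  obtain ⟨p, s, a, b, q, rfl | rfl⟩ := exists_eq_edge c
  · rfl
  · exact (inv_inv _).symm

theorem cellValue_commute (p q r u₁ v₁ u₂ v₂ : List Letter)
    (h₁ : (u₁, v₁) ∈ presentation.rules ∨ (v₁, u₁) ∈ presentation.rules)
    (h₂ : (u₂, v₂) ∈ presentation.rules ∨ (v₂, u₂) ∈ presentation.rules) :
    cellValue ⟨p, u₁, v₁, q ++ u₂ ++ r, h₁⟩ * cellValue ⟨p ++ v₁ ++ q, u₂, v₂, r, h₂⟩ =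
      cellValue ⟨p ++ u₁ ++ q, u₂, v₂, r, h₂⟩ * cellValue ⟨p, u₁, v₁, q ++ v₂ ++ r, h₁⟩ := by
  -- Either cell may use its rule backwards; these are the other three orientations of the same
  -- square.
  have square {G : Type} [Group G] {a b c d : G} (h : a * b = c * d) :
      a⁻¹ * c = b * d⁻¹ ∧ d * b⁻¹ = c⁻¹ * a ∧ d⁻¹ * c⁻¹ = b⁻¹ * a⁻¹ := by
    refine ⟨?_, ?_, ?_⟩
    · rw [eq_mul_inv_iff_mul_eq, mul_assoc, ← h, inv_mul_cancel_left]
    · rw [mul_inv_eq_iff_eq_mul, mul_assoc, h, inv_mul_cancel_left]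
    · rw [← mul_inv_rev, ← mul_inv_rev, h]
  rcases h₁ with h₁ | h₁ <;> rcases h₂ with h₂ | h₂ <;>
    obtain ⟨s₁, a₁, b₁, rfl, rfl⟩ := eq_of_rule_mem h₁ <;>
    obtain ⟨s₂, a₂, b₂, rfl, rfl⟩ := eq_of_rule_mem h₂ <;>
    have key := edgeValue_mul_edgeValue p q r s₁ a₁ b₁ s₂ a₂ b₂
  · exact key
  · exact (square key).2.1
  · exact (square key).1
  · exact (square key).2.2

theorem prod_cellValue_eq_of_move {a b : List Letter} {d e : presentation.Diagram a b}
    (h : Diagram.Move d e) : (d.cells.map cellValue).prod = (e.cells.map cellValue).prod := by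
  cases h with
  | dipole l₁ l₂ c => simp [cellValue_inv]
  | commute l₁ l₂ p q r u₁ v₁ u₂ v₂ h₁ h₂ =>
    have key := cellValue_commute p q r u₁ v₁ u₂ v₂ h₁ h₂
    simp only [List.map_append, List.prod_append, List.map_cons, List.map_nil, List.prod_cons,
      List.prod_nil, mul_one, key]

/-- The homomorphism that multiplies the values of the cells of a diagram. -/
def toPresented : VF →* PresentedGroup relators where
  toFun := Quot.lift (fun d => (d.cells.map cellValue).prod)
    (fun _ _ h => prod_cellValue_eq_of_move h)
  map_one' := rfl
  map_mul' := by
    rintro ⟨d⟩ ⟨e⟩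
    exact (congrArg List.prod (List.map_append ..)).trans List.prod_append

theorem toPresented_toClass (d : presentation.Diagram [x] [x]) :
    toPresented d.toClass = (d.cells.map cellValue).prod := rfl

theorem prod_cellValue_treeCells : (w : List Letter) →
    ((treeCells w).map cellValue).prod = 1
  | [] => by simp [treeCells]
  | [x] => by simp [treeCells]
  | [v] => by simp [treeCells, cellValue_inv, cellValue_edge, edgeValue]
  | [a, b] => by simp [treeCells, cellValue_edge, edgeValue]
  | a :: b :: c :: u => by
    rw [treeCells, List.map_append, List.prod_append, prod_cellValue_treeCells (a :: c :: u)]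
    cases a <;> simp [cellValue_edge, edgeValue]
termination_by w => w.length

theorem prod_cellValue_map_inv (l : List presentation.Cell) :
    ((l.reverse.map Cell.inv).map cellValue).prod = (l.map cellValue).prod⁻¹ := by
  induction l with
  | nil => simp
  | cons c l ih => simp_all [cellValue_inv]

/-- The two tree paths contribute 1, since `edgeValue` is trivial on tree cells. -/
theorem toPresented_loop (c : presentation.Cell) : toPresented (loop c) = cellValue c := by
  rw [loop, closeUp, toPresented_toClass]
  simp only [Diagram.comp, Diagram.inv, Diagram.single, tree, List.map_append, List.prod_append,
    prod_cellValue_map_inv, prod_cellValue_treeCells]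
  simp

theorem cellValue_cell (g : Gen) : cellValue g.cell = .of g := by
  cases g with
  | v_vv | v_vx | v_xv | X => rfl
  | x_vv u hu | x_vx u hu | v_xx u hu | v_xv' u hu =>
    obtain ⟨c, u, rfl⟩ := List.exists_cons_of_ne_nil hu
    rfl

theorem ofPresented_edgeValue (p : List Letter) (s a b : Letter) (q : List Letter) :
    ofPresented (edgeValue p s a b q) = loop (edge p s a b q) := by
  cases p with
  | cons h p => exact (ofPresented_of _).trans (loop_edge_cons h p s a b q).symm
  | nil =>
    cases q <;> cases s <;> cases a <;> cases b <;>
      first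
      | exact ofPresented_of _
      | exact (map_one _).trans (loop_edge_x _ _).symm
      | exact (map_one _).trans loop_edge_v_xx.symm
      | exact (map_one _).trans (loop_edge_nil_self_cons _ _ _ _).symm

theorem ofPresented_cellValue (c : presentation.Cell) : ofPresented (cellValue c) = loop c := by
  obtain ⟨p, s, a, b, q, rfl | rfl⟩ := exists_eq_edge c
  · exact ofPresented_edgeValue p s a b q
  · rw [cellValue_inv, loop_inv, map_inv, cellValue_edge, ofPresented_edgeValue]

/-- The isomorphism from the presented group to `VF`. -/
def presentedEquiv : PresentedGroup relators ≃* VF :=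
  MonoidHom.toMulEquiv ofPresented toPresented
    (PresentedGroup.ext fun g => by
      simp [ofPresented_of, toPresented_loop, cellValue_cell])
    (MonoidHom.ext fun d => by
      obtain ⟨d, rfl⟩ : ∃ e : presentation.Diagram [x] [x], e.toClass = d := Quot.exists_rep d
      -- The tree path to `x` is empty, so a diagram from `x` to `x` is already closed up and equals
      -- the product of the loops of its cells.
      have h := closeUp_mk (by simp) (by simp) d.cells d.isDiagram
      simp only [MonoidHom.comp_apply, MonoidHom.id_apply, toPresented_toClass, map_list_prod,
        List.map_map, Function.comp_def, ofPresented_cellValue]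
      exact h.symm.trans (closeUp_self d))

theorem presentedEquiv_of (g : Gen) : presentedEquiv (.of g) = loop g.cell := ofPresented_of g

/-! ### The free product decomposition -/

section FreeProduct

variable {G : Type*} [Group G] (φ : PresentedGroup relators ≃* G)

/-- The subgroup generated by the generators other than `X_{v → vv}`, `X_{v → vx}` and
`X_{v → xv}`. -/
abbrev otherSubgroup : Subgroup G :=
  Subgroup.closure ((fun g => φ (PresentedGroup.of g)) '' otherGens)

theorem apply_mem_otherSubgroup {g : Gen} (hg : g ∈ otherGens) :
    φ (.of g) ∈ otherSubgroup φ := Subgroup.subset_closure ⟨g, hg, rfl⟩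

open Classical in
/-- The factor of the free product that a generator belongs to. -/
noncomputable def coprodGen (g : Gen) : Monoid.Coprod (FreeGroup (Fin 3)) (otherSubgroup φ) :=
  if hg : g ∈ otherGens then .inr ⟨φ (.of g), apply_mem_otherSubgroup φ hg⟩
  else match g with
    | .v_vv => .inl (.of 0)
    | .v_vx => .inl (.of 1)
    | _ => .inl (.of 2)

theorem coprodGen_of_mem {g : Gen} (hg : g ∈ otherGens) :
    coprodGen φ g = .inr ⟨φ (.of g), apply_mem_otherSubgroup φ hg⟩ := dif_pos hg

theorem coprodGen_v_vv : coprodGen φ .v_vv = .inl (.of 0) := dif_neg (by simp [otherGens])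
theorem coprodGen_v_vx : coprodGen φ .v_vx = .inl (.of 1) := dif_neg (by simp [otherGens])
theorem coprodGen_v_xv : coprodGen φ .v_xv = .inl (.of 2) := dif_neg (by simp [otherGens])

theorem coprodGen_mul_eq {g₁ g₂ g₃ g₄ : Gen} (h₁ : g₁ ∈ otherGens) (h₂ : g₂ ∈ otherGens)
    (h₃ : g₃ ∈ otherGens) (h₄ : g₄ ∈ otherGens)
    (h : IsRelation (.of g₁ * .of g₂) (.of g₃ * .of g₄)) :
    coprodGen φ g₁ * coprodGen φ g₂ = coprodGen φ g₃ * coprodGen φ g₄ := by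
  rw [coprodGen_of_mem φ h₁, coprodGen_of_mem φ h₂, coprodGen_of_mem φ h₃, coprodGen_of_mem φ h₄,
    ← map_mul, ← map_mul]
  congr 1
  ext
  simp only [Subgroup.coe_mul, ← map_mul, of_mul_of_eq h]

/-- Every relation involves only generators in `otherGens`, so it already holds in the right factor.
-/
theorem coprodGen_lift_relators : ∀ r ∈ relators, FreeGroup.lift (coprodGen φ) r = 1 := by
  rintro _ ⟨l, r, h, rfl⟩
  rw [map_mul, map_inv, mul_inv_eq_one]
  cases id h <;> simp only [map_mul, FreeGroup.lift_apply_of] <;>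
    exact coprodGen_mul_eq φ (by simp [otherGens]) (by simp [otherGens]) (by simp [otherGens])
      (by simp [otherGens]) h

theorem bijective_coprod_lift : Function.Bijective
    (Monoid.Coprod.lift
      (FreeGroup.lift ![φ (.of .v_vv), φ (.of .v_vx), φ (.of .v_xv)])
      (otherSubgroup φ).subtype) := by
  set F := Monoid.Coprod.lift
      (FreeGroup.lift ![φ (.of .v_vv), φ (.of .v_vx), φ (.of .v_xv)])
      (otherSubgroup φ).subtype with hF
  let f : PresentedGroup relators →* Monoid.Coprod (FreeGroup (Fin 3)) (otherSubgroup φ) :=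
    PresentedGroup.toGroup (coprodGen_lift_relators φ)
  have f_of (g : Gen) : f (.of g) = coprodGen φ g :=
    PresentedGroup.toGroup.of (coprodGen_lift_relators φ)
  -- The map `f`, transported along `φ`, is a two-sided inverse of `F`: this identity gives
  -- surjectivity and `hfF` gives injectivity.
  have hFf : F.comp f = φ.toMonoidHom := by
    refine PresentedGroup.ext fun g => ?_
    rw [MonoidHom.comp_apply, f_of]
    by_cases hg : g ∈ otherGens
    · rw [coprodGen_of_mem φ hg]
      simp [hF]
    · obtain rfl | rfl | rfl : g = .v_vv ∨ g = .v_vx ∨ g = .v_xv := by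
        simp only [otherGens, Set.mem_ofPred_eq] at hg
        tauto
      · simp [coprodGen_v_vv, hF]
      · simp [coprodGen_v_vx, hF]
      · simp [coprodGen_v_xv, hF]
  have hfF : (f.comp φ.symm.toMonoidHom).comp F = MonoidHom.id _ := by
    refine Monoid.Coprod.hom_ext ?_ ?_
    · refine FreeGroup.ext_hom _ _ fun i => ?_
      fin_cases i
      · simp [hF, f_of, coprodGen_v_vv]
      · simp [hF, f_of, coprodGen_v_vx]
      · simp [hF, f_of, coprodGen_v_xv]
    -- The right factor is the closure of its generators, so agreement on these suffices.
    · refine MonoidHom.eq_of_eqOn_dense (s := Subtype.val ⁻¹' _)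
        (Subgroup.closure_closure_coe_preimage (k :=
          (fun g => φ (PresentedGroup.of g)) '' otherGens)) ?_
      rintro ⟨_, _⟩ ⟨g, hg, rfl⟩
      simp [hF, f_of, coprodGen_of_mem φ hg]
  constructor
  · exact Function.LeftInverse.injective (g := fun y => f (φ.symm y)) (DFunLike.congr_fun hfF)
  · intro g
    exact ⟨f (φ.symm g), (DFunLike.congr_fun hFf (φ.symm g)).trans (φ.apply_symm_apply g)⟩

end FreeProduct

end VirtualThompson

theorem mainTheorem3 :
    ∃ φ : PresentedGroup VirtualThompson.relators ≃* VirtualThompson.VF,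
      -- the generator named after a cell is represented by a diagram through that cell,
      -- closed up by diagrams that depend only on the top and the bottom word of the cell
      (∃ T : (w : List VirtualThompson.Letter) → w ≠ [] →
          VirtualThompson.presentation.Diagram [VirtualThompson.Letter.x] w,
        ∀ g : VirtualThompson.Gen,
          φ (PresentedGroup.of g) =
            (((T g.cell.top g.cell.top_ne_nil).comp
              (SemigroupPresentation.Diagram.single g.cell)).comp
                (T g.cell.bot g.cell.bot_ne_nil).inv).toClass) ∧
      -- `VF` is the free product of the free group on the first three generators and the
      -- subgroup generated by all the other generators
      Function.Bijective
        (Monoid.Coprod.lift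
          (FreeGroup.lift
            ![φ (PresentedGroup.of VirtualThompson.Gen.v_vv),
              φ (PresentedGroup.of VirtualThompson.Gen.v_vx),
              φ (PresentedGroup.of VirtualThompson.Gen.v_xv)])
          (Subgroup.closure
            ((fun g => φ (PresentedGroup.of g)) '' VirtualThompson.otherGens)).subtype) :=
  ⟨VirtualThompson.presentedEquiv,
    ⟨VirtualThompson.tree, VirtualThompson.presentedEquiv_of⟩,
    VirtualThompson.bijective_coprod_lift _⟩
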